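/- Let $m\in\mathbb N$, $\alpha>0$, $a_0\in\mathbb R$, $b\in\mathbb R^m$, $q\in\mathbb R^{2m}$, and let $A:\mathbb R^{2m}\to\mathbb R^m$ be linear. Write $\lambda=(\lambda_1,\dots,\lambda_m)\in\mathbb R^{2m}$ with blocks $\lambda_i\in\mathbb R^2$, let $\|\cdot\|$ and $\langle\cdot,\cdot\rangle$ be the Euclidean norm and inner product, let $\mathbb B_\alpha=\{x\in\mathbb R^2:\|x\|\le\alpha\}$, and let $\mathcal I_{\mathbb B_\alpha}$ be its indicator function ($0$ on $\mathbb B_\alpha$, $+\infty$ elsewhere). Consider the convex function $$f(\lambda)=\tfrac12\|A\lambda-b\|^2+\langle q,\lambda\rangle+a_0+\sum_{i=1}^m\mathcal I_{\mathbb B_\alpha}(\lambda_i).$$ Let $\bar\lambda$ be a minimizer of $f$, and put $\bar g=A^T(A\bar\lambda-b)+q=(\bar g_1,\dots,\bar g_m)$, $\bar g_i\in\mathbb R^2$. Suppose that for every $i$ either $\bar\lambda_i\in\operatorname{int}\mathbb B_\alpha$, or $\bar\lambda_i\in\operatorname{bd}\mathbb B_\alpha$, $\bar g_i\ne0$ and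 $-\bar g_i\in\mathcal N_{\mathbb B_\alpha}(\bar\lambda_i)=\partial\mathcal I_{\mathbb B_\alpha}(\bar\lambda_i)$. Then the convex subdifferential $\partial f$ is metrically subregular at $\bar\lambda$ for $0$: $0\in\partial f(\bar\lambda)$, and there exist $\kappa\ge0$ and neighborhoods $U$ of $\bar\lambda$ and $V$ of $0$ such that $$\operatorname{dist}\bigl(\lambda,(\partial f)^{-1}(0)\bigr)\le\kappa\,\operatorname{dist}\bigl(0,\partial f(\lambda)\cap V\bigr)\qquad\text{for all }\lambda\in U,$$ where $\operatorname{dist}(x,C)=\inf_{x'\in C}\|x-x'\|$; at the points $\lambda$ with $\partial f(\lambda)\cap V=\emptyset$ the right-hand distance is $+\infty$ and the inequality imposes no condition. -/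

import Mathlib

open scoped ENNReal NNReal RealInnerProductSpace

noncomputable section

/-- Indicator function of a set in the sense of convex analysis: `0` on `C`, `+∞` off `C`. -/
def convexIndicator {E : Type*} (C : Set E) (x : E) : EReal :=
  open Classical in if x ∈ C then 0 else ⊤

/-- The convex subdifferential of an extended-real-valued function. -/
def subdifferential {E : Type*} [NormedAddCommGroup E] [InnerProductSpace ℝ E]
    (f : E → EReal) (x : E) : Set E :=
  {v | ∀ y, f x + ((⟪v, y - x⟫ : ℝ) : EReal) ≤ f y}

/-- The normal cone of `C` at `x`, as the subdifferential of the indicator function of `C`. -/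
def normalCone {E : Type*} [NormedAddCommGroup E] [InnerProductSpace ℝ E]
    (C : Set E) (x : E) : Set E :=
  subdifferential (convexIndicator C) x

/-- Metric subregularity of a set-valued map `F` at `x₀` for `y₀`. The distance to a set is
`Metric.infEDist`, whose value at the empty set is `+∞`, so that the estimate is void at the
points `x` where `F x ∩ V` is empty. -/
def MetricallySubregularAt {X Y : Type*} [PseudoEMetricSpace X] [PseudoEMetricSpace Y]
    (F : X → Set Y) (x₀ : X) (y₀ : Y) : Prop :=
  y₀ ∈ F x₀ ∧ ∃ κ : ℝ≥0, ∃ U ∈ nhds x₀, ∃ V ∈ nhds y₀, ∀ x ∈ U,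
    Metric.infEDist x {x' | y₀ ∈ F x'} ≤ (κ : ℝ≥0∞) * Metric.infEDist y₀ (F x ∩ V)

/-- The space `ℝ^{2m}` of vectors `(λ₁, …, λₘ)` of blocks `λᵢ ∈ ℝ²`, with the Euclidean norm. -/
abbrev DualSpace (m : ℕ) : Type :=
  PiLp 2 (fun _ : Fin m => EuclideanSpace ℝ (Fin 2))

/-- The dual objective
`½ ‖A λ - b‖² + ⟨q, λ⟩ + a₀ + ∑ᵢ I(λᵢ)`, `I` the indicator of the closed `α`-ball of `ℝ²`. -/
def dualObjective {m : ℕ} (A : DualSpace m →ₗ[ℝ] EuclideanSpace ℝ (Fin m))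
    (b : EuclideanSpace ℝ (Fin m)) (q : DualSpace m) (a₀ α : ℝ) (l : DualSpace m) : EReal :=
  ((‖A l - b‖ ^ 2 / 2 + ⟪q, l⟫ + a₀ : ℝ) : EReal)
    + ∑ i, convexIndicator (Metric.closedBall (0 : EuclideanSpace ℝ (Fin 2)) α) (l i)

/-- The gradient `Aᵀ(A λ - b) + q` at `λ` of the smooth part of the dual objective. -/
def dualGradient {m : ℕ} (A : DualSpace m →ₗ[ℝ] EuclideanSpace ℝ (Fin m))
    (b : EuclideanSpace ℝ (Fin m)) (q : DualSpace m) (l : DualSpace m) : DualSpace m :=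
  LinearMap.adjoint A (A l - b) + q

/-- Each block `lᵢ` lies in the interior of the closed `α`-ball, or it lies on its boundary and the
`i`-th block of the gradient is nonzero, its negative being a normal of the ball at `lᵢ`. -/
def BlockCondition {m : ℕ} (A : DualSpace m →ₗ[ℝ] EuclideanSpace ℝ (Fin m))
    (b : EuclideanSpace ℝ (Fin m)) (q : DualSpace m) (α : ℝ) (l : DualSpace m) : Prop :=
  ∀ i, (l i ∈ frontier (Metric.closedBall (0 : EuclideanSpace ℝ (Fin 2)) α) ∧
      dualGradient A b q l i ≠ 0 ∧
      -dualGradient A b q l i ∈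
        normalCone (Metric.closedBall (0 : EuclideanSpace ℝ (Fin 2)) α) (l i)) ∨
    l i ∈ interior (Metric.closedBall (0 : EuclideanSpace ℝ (Fin 2)) α)

end

open scoped ENNReal NNReal RealInnerProductSpace

/-! Write `g` for the gradient at the minimizer and `T` for `growthMap`. Since `-gᵢ` is normal to a
round ball, its curvature gives `‖gᵢ‖ ‖dᵢ‖² ≤ 2α ⟪gᵢ, dᵢ⟫` (`norm_mul_norm_sub_sq_le_inner`), so the
objective grows by at least `‖T d‖² / (2(1+α))` along a feasible step `d`. Along `ker T` the smooth
part is constant, and such a step moves only blocks with `gᵢ = 0`. These are interior by the block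
condition, so small kernel steps stay feasible and reach minimizers. Since `d` lies within `c ‖T d‖`
of `ker T`, growth bounds the squared distance `D²` to such a minimizer by `2c²(1+α)` times the
objective gap. A subgradient `v` bounds the gap by `‖v‖ D`; cancelling `D` gives the estimate. -/

/-- Modulo its kernel, a linear map between finite-dimensional spaces is bounded below; the kernel
component of a vector can be taken no longer than the vector. -/
theorem LinearMap.exists_ker_norm_sub_le {E F : Type*} [NormedAddCommGroup E]
    [InnerProductSpace ℝ E] [FiniteDimensional ℝ E] [NormedAddCommGroup F] [NormedSpace ℝ F]
    (T : E →ₗ[ℝ] F) :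
    ∃ c : ℝ, 0 < c ∧ ∀ d, ∃ k, T k = 0 ∧ ‖k‖ ≤ ‖d‖ ∧ ‖d - k‖ ≤ c * ‖T d‖ := by
  have hker : LinearMap.ker (T.domRestrict (LinearMap.ker T)ᗮ) = ⊥ := by
    refine LinearMap.ker_eq_bot'.2 fun x hx => ?_
    have hx' : (x : E) ∈ LinearMap.ker T := hx
    exact Subtype.ext (inner_self_eq_zero.1 ((Submodule.mem_orthogonal _ _).1 x.2 x hx'))
  obtain ⟨K, hK, hT⟩ := LinearMap.exists_antilipschitzWith _ hker
  refine ⟨K, hK, fun d => ⟨(LinearMap.ker T).starProjection d, ?_, ?_, ?_⟩⟩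
  · exact (LinearMap.ker T).starProjection_apply_mem d
  · exact (LinearMap.ker T).norm_starProjection_apply_le d
  · have hmem : d - (LinearMap.ker T).starProjection d ∈ (LinearMap.ker T)ᗮ :=
      Submodule.sub_starProjection_mem_orthogonal d
    have h0 : T ((LinearMap.ker T).starProjection d) = 0 :=
      (LinearMap.ker T).starProjection_apply_mem d
    have h := hT.le_mul_dist ⟨_, hmem⟩ 0
    simpa [dist_zero_right, h0] using h

/-- If `-g` is normal to the closed `α`-ball at `x`, then `g` is a multiple of `-x`. -/
theorem norm_smul_eq_of_forall_inner_nonneg {E : Type*} [NormedAddCommGroup E]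
    [InnerProductSpace ℝ E] {α : ℝ} (hα : 0 < α) {g x : E} (hx : ‖x‖ ≤ α)
    (h : ∀ y, ‖y‖ ≤ α → 0 ≤ ⟪g, y - x⟫) : ‖g‖ • x = -(α • g) := by
  rcases eq_or_ne g 0 with rfl | hg
  · simp
  have hg' : 0 < ‖g‖ := norm_pos_iff.2 hg
  -- The test point minimizes `⟪g, ·⟫` over the ball. It yields `⟪g, x⟫ ≤ -α ‖g‖`, the equality case
  -- of Cauchy–Schwarz.
  have h1 := h (-(α / ‖g‖) • g) (by
    rw [norm_smul, norm_neg, Real.norm_of_nonneg (by positivity), div_mul_cancel₀ _ hg'.ne'])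
  rw [inner_sub_right, inner_smul_right, real_inner_self_eq_norm_sq] at h1
  have h2 : -(α / ‖g‖) * ‖g‖ ^ 2 = -(α * ‖g‖) := by field_simp
  rw [h2] at h1
  have h3 : ‖‖g‖ • x + α • g‖ ^ 2 ≤ 0 := by
    rw [norm_add_sq_real, norm_smul, norm_smul, norm_norm, Real.norm_of_nonneg hα.le,
      real_inner_smul_left, real_inner_smul_right, real_inner_comm]
    have h4 : ‖x‖ ^ 2 ≤ α ^ 2 := pow_le_pow_left₀ (norm_nonneg _) hx 2
    have h5 : 0 ≤ (α * ‖g‖) * (-(α * ‖g‖) - ⟪g, x⟫) := mul_nonneg (by positivity) h1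
    nlinarith [mul_nonneg (sq_nonneg ‖g‖) (sub_nonneg.2 h4)]
  have h4 : ‖‖g‖ • x + α • g‖ = 0 := by
    have := sq_nonneg ‖‖g‖ • x + α • g‖
    exact pow_eq_zero_iff (two_ne_zero) |>.1 (le_antisymm h3 this)
  exact eq_neg_of_add_eq_zero_left (norm_eq_zero.1 h4)

/-- A vector normal to a ball at an interior point vanishes. -/
theorem eq_zero_of_forall_inner_nonneg_of_norm_lt {E : Type*} [NormedAddCommGroup E]
    [InnerProductSpace ℝ E] {α : ℝ} (hα : 0 < α) {g x : E} (hx : ‖x‖ < α)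
    (h : ∀ y, ‖y‖ ≤ α → 0 ≤ ⟪g, y - x⟫) : g = 0 := by
  have h1 := congrArg norm (norm_smul_eq_of_forall_inner_nonneg hα hx.le h)
  rw [norm_neg, norm_smul, norm_smul, norm_norm, Real.norm_of_nonneg hα.le] at h1
  by_contra hg
  nlinarith [norm_pos_iff.2 hg]

/-- Quadratic growth over a ball of a linear functional away from its minimizer. -/
theorem norm_mul_norm_sub_sq_le_inner {E : Type*} [NormedAddCommGroup E]
    [InnerProductSpace ℝ E] {α : ℝ} (hα : 0 < α) {g x : E} (hx : ‖x‖ ≤ α)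
    (h : ∀ y, ‖y‖ ≤ α → 0 ≤ ⟪g, y - x⟫) {y : E} (hy : ‖y‖ ≤ α) :
    ‖g‖ * ‖y - x‖ ^ 2 ≤ 2 * α * ⟪g, y - x⟫ := by
  rcases hx.lt_or_eq with hlt | heq
  · simp [eq_zero_of_forall_inner_nonneg_of_norm_lt hα hlt h]
  have h1 := norm_smul_eq_of_forall_inner_nonneg hα hx h
  have h2 : ‖g‖ * ⟪x, y - x⟫ = -(α * ⟪g, y - x⟫) := by
    rw [← real_inner_smul_left, h1, inner_neg_left, real_inner_smul_left]
  have h3 : ‖y‖ ^ 2 = ‖x‖ ^ 2 + 2 * ⟪x, y - x⟫ + ‖y - x‖ ^ 2 := by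
    rw [← norm_add_sq_real, add_sub_cancel]
  have h4 : ‖y‖ ^ 2 ≤ ‖x‖ ^ 2 := by
    rw [heq]; exact pow_le_pow_left₀ (norm_nonneg _) hy 2
  have h5 : ‖g‖ * ‖y - x‖ ^ 2 ≤ ‖g‖ * (-(2 * ⟪x, y - x⟫)) :=
    mul_le_mul_of_nonneg_left (by linarith) (norm_nonneg _)
  linarith

/-- `K ≠ 0` matters for empty `s`: the distance is then `⊤`, but `0 * ⊤ = 0`. -/
theorem Metric.le_mul_infEDist {X : Type*} [PseudoEMetricSpace X] {K : ℝ≥0} (hK : K ≠ 0)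
    {a : ℝ≥0∞} {x : X} {s : Set X} (h : ∀ y ∈ s, a ≤ K * edist x y) :
    a ≤ K * Metric.infEDist x s := by
  simp only [Metric.infEDist, ENNReal.mul_iInf_of_ne (ENNReal.coe_ne_zero.2 hK) ENNReal.coe_ne_top]
  exact le_iInf₂ h

section DualObjective

variable {m : ℕ} (A : DualSpace m →ₗ[ℝ] EuclideanSpace ℝ (Fin m))
  (b : EuclideanSpace ℝ (Fin m)) (q : DualSpace m) (a₀ : ℝ) {α : ℝ}

theorem convexIndicator_nonneg {E : Type*} (C : Set E) (x : E) : 0 ≤ convexIndicator C x := by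
  unfold convexIndicator
  split_ifs <;> simp

theorem dualObjective_of_forall_norm_le {l : DualSpace m} (hl : ∀ i, ‖l i‖ ≤ α) :
    dualObjective A b q a₀ α l = ((‖A l - b‖ ^ 2 / 2 + ⟪q, l⟫ + a₀ : ℝ) : EReal) := by
  have h : ∀ i, convexIndicator (Metric.closedBall (0 : EuclideanSpace ℝ (Fin 2)) α) (l i) = 0 :=
    fun i => if_pos (mem_closedBall_zero_iff.2 (hl i))
  simp [dualObjective, h]

theorem dualObjective_eq_top {l : DualSpace m} (hl : ¬ ∀ i, ‖l i‖ ≤ α) :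
    dualObjective A b q a₀ α l = ⊤ := by
  obtain ⟨j, hj⟩ := not_forall.1 hl
  have h : convexIndicator (Metric.closedBall (0 : EuclideanSpace ℝ (Fin 2)) α) (l j) = ⊤ :=
    if_neg fun h => hj (mem_closedBall_zero_iff.1 h)
  have hs : ∑ i, convexIndicator (Metric.closedBall (0 : EuclideanSpace ℝ (Fin 2)) α) (l i) = ⊤ :=
    top_le_iff.1 (h ▸ Finset.single_le_sum
      (f := fun i => convexIndicator (Metric.closedBall (0 : EuclideanSpace ℝ (Fin 2)) α) (l i))
      (fun i _ => convexIndicator_nonneg _ _) (Finset.mem_univ j))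
  rw [dualObjective, hs]
  exact EReal.coe_add_top _

/-- Taylor expansion of the smooth part of the dual objective. -/
theorem dualObjective_smooth_add (l d : DualSpace m) :
    ‖A (l + d) - b‖ ^ 2 / 2 + ⟪q, l + d⟫ + a₀ =
      (‖A l - b‖ ^ 2 / 2 + ⟪q, l⟫ + a₀) + ⟪dualGradient A b q l, d⟫ + ‖A d‖ ^ 2 / 2 := by
  have h : A (l + d) - b = (A l - b) + A d := by rw [map_add]; abel
  rw [h, norm_add_sq_real, dualGradient, inner_add_left, inner_add_right,
    LinearMap.adjoint_inner_left]
  ring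

variable {A b q a₀}

/-- First-order optimality, block by block. -/
theorem inner_dualGradient_nonneg {lbar : DualSpace m} (hbar : ∀ i, ‖lbar i‖ ≤ α)
    (hsol : ∀ l : DualSpace m, dualObjective A b q a₀ α lbar ≤ dualObjective A b q a₀ α l)
    (i : Fin m) (y : EuclideanSpace ℝ (Fin 2)) (hy : ‖y‖ ≤ α) :
    0 ≤ ⟪dualGradient A b q lbar i, y - lbar i⟫ := by
  set d : DualSpace m := PiLp.single 2 i (y - lbar i) with hd
  have hinner : ⟪dualGradient A b q lbar, d⟫ = ⟪dualGradient A b q lbar i, y - lbar i⟫ := by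
    rw [PiLp.inner_apply, Finset.sum_eq_single i]
    · simp [hd]
    · intro j _ hj
      simp [hd, hj]
    · simp
  rw [← hinner]
  -- Difference quotient along the feasible segment towards `y`; letting `t → 0⁺` removes the
  -- quadratic term.
  have key : ∀ t : ℝ, 0 < t → t ≤ 1 →
      0 ≤ ⟪dualGradient A b q lbar, d⟫ + t * (‖A d‖ ^ 2 / 2) := by
    intro t ht ht1
    have hmem : ∀ j, ‖(lbar + t • d) j‖ ≤ α := by
      intro j
      rcases eq_or_ne j i with rfl | hj
      · have h : (lbar + t • d) j = (1 - t) • lbar j + t • y := by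
          simp only [hd, PiLp.add_apply, PiLp.smul_apply, PiLp.single_eq_same]
          module
        rw [h]
        have := convex_closedBall (0 : EuclideanSpace ℝ (Fin 2)) α
          (mem_closedBall_zero_iff.2 (hbar j)) (mem_closedBall_zero_iff.2 hy)
          (sub_nonneg.2 ht1) ht.le (sub_add_cancel _ _)
        exact mem_closedBall_zero_iff.1 this
      · simpa [hd, hj] using hbar j
    have h := hsol (lbar + t • d)
    rw [dualObjective_of_forall_norm_le _ _ _ _ hbar, dualObjective_of_forall_norm_le _ _ _ _ hmem,
      EReal.coe_le_coe_iff, dualObjective_smooth_add, map_smul, norm_smul, inner_smul_right,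
      Real.norm_of_nonneg ht.le] at h
    have h' : 0 ≤ t * (⟪dualGradient A b q lbar, d⟫ + t * (‖A d‖ ^ 2 / 2)) := by
      linarith
    exact nonneg_of_mul_nonneg_right h' ht
  have hlim : Filter.Tendsto (fun t : ℝ => ⟪dualGradient A b q lbar, d⟫ + t * (‖A d‖ ^ 2 / 2))
      (nhdsWithin 0 (Set.Ioi 0)) (nhds ⟪dualGradient A b q lbar, d⟫) := by
    have : Continuous fun t : ℝ => ⟪dualGradient A b q lbar, d⟫ + t * (‖A d‖ ^ 2 / 2) := by
      fun_prop
    simpa using (this.tendsto 0).mono_left nhdsWithin_le_nhds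
  refine ge_of_tendsto hlim ?_
  filter_upwards [Ioc_mem_nhdsGT (zero_lt_one : (0 : ℝ) < 1)] with t ht using key t ht.1 ht.2

/-- The linear map sending `d` to `A d` and to the blocks `dᵢ` weighted by `√‖gᵢ‖`. -/
noncomputable def growthMap (A : DualSpace m →ₗ[ℝ] EuclideanSpace ℝ (Fin m)) (g : DualSpace m) :
    DualSpace m →ₗ[ℝ] EuclideanSpace ℝ (Fin m) × DualSpace m :=
  A.prod
    { toFun := fun d => WithLp.toLp 2 fun i => √‖g i‖ • d i
      map_add' := fun x y => by ext; simp
      map_smul' := fun c x => by ext; simp [mul_left_comm] }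

theorem growthMap_eq_zero_iff {g d : DualSpace m} :
    growthMap A g d = 0 ↔ A d = 0 ∧ ∀ i, g i = 0 ∨ d i = 0 := by
  constructor
  · intro h
    refine ⟨congrArg Prod.fst h, fun i => ?_⟩
    have h' : √‖g i‖ • d i = 0 := congrArg (fun x : _ × DualSpace m => x.2 i) h
    refine (smul_eq_zero.1 h').imp_left fun h0 => ?_
    exact norm_eq_zero.1 ((Real.sqrt_eq_zero (norm_nonneg _)).1 h0)
  · rintro ⟨h1, h2⟩
    refine Prod.ext h1 (PiLp.ext fun i => ?_)
    change √‖g i‖ • d i = 0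
    rcases h2 i with h | h <;> simp [h]

/-- Only an inequality, because the product carries the sup norm. -/
theorem norm_growthMap_sq_le (g d : DualSpace m) :
    ‖growthMap A g d‖ ^ 2 ≤ ‖A d‖ ^ 2 + ∑ i, ‖g i‖ * ‖d i‖ ^ 2 := by
  have h2 : ‖(growthMap A g d).2‖ ^ 2 = ∑ i, ‖g i‖ * ‖d i‖ ^ 2 := by
    rw [PiLp.norm_sq_eq_of_L2]
    refine Finset.sum_congr rfl fun i _ => ?_
    change ‖√‖g i‖ • d i‖ ^ 2 = _
    rw [norm_smul, mul_pow, Real.norm_of_nonneg (Real.sqrt_nonneg _),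
      Real.sq_sqrt (norm_nonneg _)]
  have h1 : (growthMap A g d).1 = A d := rfl
  rw [Prod.norm_def, ← h2, h1]
  rcases max_choice ‖A d‖ ‖(growthMap A g d).2‖ with h | h <;> rw [h] <;>
    nlinarith [sq_nonneg ‖A d‖, sq_nonneg ‖(growthMap A g d).2‖]

/-- Quadratic growth of the dual objective at a minimizer, measured by `growthMap`. -/
theorem norm_growthMap_sq_le_growth (hα : 0 < α) {lbar : DualSpace m}
    (hbar : ∀ i, ‖lbar i‖ ≤ α)
    (hsol : ∀ l : DualSpace m, dualObjective A b q a₀ α lbar ≤ dualObjective A b q a₀ α l)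
    {d : DualSpace m} (hd : ∀ i, ‖(lbar + d) i‖ ≤ α) :
    ‖growthMap A (dualGradient A b q lbar) d‖ ^ 2 ≤
      2 * (1 + α) * (⟪dualGradient A b q lbar, d⟫ + ‖A d‖ ^ 2 / 2) := by
  have hi : ∀ i, ‖dualGradient A b q lbar i‖ * ‖d i‖ ^ 2 ≤
      2 * α * ⟪dualGradient A b q lbar i, d i⟫ := fun i => by
    simpa using norm_mul_norm_sub_sq_le_inner hα (hbar i)
      (inner_dualGradient_nonneg hbar hsol i) (hd i)
  have hsum := Finset.sum_le_sum fun i (_ : i ∈ Finset.univ) => hi i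
  rw [← Finset.mul_sum, ← PiLp.inner_apply] at hsum
  have hnn : 0 ≤ ⟪dualGradient A b q lbar, d⟫ := by
    have : 0 ≤ ∑ i, ‖dualGradient A b q lbar i‖ * ‖d i‖ ^ 2 := by positivity
    exact nonneg_of_mul_nonneg_right (this.trans hsum) (by positivity)
  -- The slack is `2 ⟪g, d⟫ + α ‖A d‖²`, both terms nonnegative.
  nlinarith [norm_growthMap_sq_le (A := A) (dualGradient A b q lbar) d,
    mul_nonneg hα.le (sq_nonneg ‖A d‖)]

/-- The value of the objective bounds a subgradient step from below. -/
theorem norm_le_and_sub_le_inner_of_mem_subdifferential {l v p : DualSpace m}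
    (hp : ∀ i, ‖p i‖ ≤ α) (hv : v ∈ subdifferential (dualObjective A b q a₀ α) l) :
    (∀ i, ‖l i‖ ≤ α) ∧
      (‖A l - b‖ ^ 2 / 2 + ⟪q, l⟫ + a₀) - (‖A p - b‖ ^ 2 / 2 + ⟪q, p⟫ + a₀) ≤ ⟪v, l - p⟫ := by
  have h := hv p
  rw [dualObjective_of_forall_norm_le _ _ _ _ hp] at h
  -- Outside the domain the objective is `⊤`, which cannot lie below its finite value at `p`.
  have hl : ∀ i, ‖l i‖ ≤ α := by
    by_contra hl
    rw [dualObjective_eq_top _ _ _ _ hl, EReal.top_add_coe, top_le_iff] at h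
    exact EReal.coe_ne_top _ h
  refine ⟨hl, ?_⟩
  rw [dualObjective_of_forall_norm_le _ _ _ _ hl, ← EReal.coe_add, EReal.coe_le_coe_iff] at h
  have h' : ⟪v, l - p⟫ = -⟪v, p - l⟫ := by rw [← inner_neg_right, neg_sub]
  linarith

/-- A minimizer admits nearby minimizers along the kernel of `growthMap`. -/
theorem dualObjective_add_eq_of_growthMap_eq_zero {lbar k : DualSpace m}
    (hk0 : growthMap A (dualGradient A b q lbar) k = 0) :
    ‖A (lbar + k) - b‖ ^ 2 / 2 + ⟪q, lbar + k⟫ + a₀ =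
      ‖A lbar - b‖ ^ 2 / 2 + ⟪q, lbar⟫ + a₀ := by
  obtain ⟨hAk, hgk⟩ := growthMap_eq_zero_iff.1 hk0
  have hginner : ⟪dualGradient A b q lbar, k⟫ = 0 := by
    rw [PiLp.inner_apply]
    refine Finset.sum_eq_zero fun i _ => ?_
    rcases hgk i with h | h <;> simp [h]
  rw [dualObjective_smooth_add, hginner, hAk]
  simp

theorem zero_mem_subdifferential_of_forall_le {E : Type*} [NormedAddCommGroup E]
    [InnerProductSpace ℝ E] {f : E → EReal} {x : E} (h : ∀ y, f x ≤ f y) :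
    0 ∈ subdifferential f x := fun y => by
  simpa using h y

/-- Error bound: subgradients control the distance to a minimizer `lbar + k`, as soon as `growthMap`
controls it. -/
theorem norm_sub_le_of_mem_subdifferential (hα : 0 < α) {lbar k l v : DualSpace m}
    (hbar : ∀ i, ‖lbar i‖ ≤ α)
    (hsol : ∀ l : DualSpace m, dualObjective A b q a₀ α lbar ≤ dualObjective A b q a₀ α l)
    (hk0 : growthMap A (dualGradient A b q lbar) k = 0) (hp : ∀ i, ‖(lbar + k) i‖ ≤ α) {c : ℝ}
    (hdist : ‖l - lbar - k‖ ≤ c * ‖growthMap A (dualGradient A b q lbar) (l - lbar)‖)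
    (hv : v ∈ subdifferential (dualObjective A b q a₀ α) l) :
    ‖l - (lbar + k)‖ ≤ c ^ 2 * (2 * (1 + α)) * ‖v‖ := by
  obtain ⟨hldom, hsub⟩ := norm_le_and_sub_le_inner_of_mem_subdifferential hp hv
  have hldom' : ∀ i, ‖(lbar + (l - lbar)) i‖ ≤ α := by simpa using hldom
  have hgrow := norm_growthMap_sq_le_growth hα hbar hsol hldom'
  have htaylor := dualObjective_smooth_add A b q a₀ lbar (l - lbar)
  rw [add_sub_cancel] at htaylor
  rw [dualObjective_add_eq_of_growthMap_eq_zero hk0] at hsub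
  have hCS := real_inner_le_norm v (l - (lbar + k))
  rw [sub_sub] at hdist
  generalize ‖l - (lbar + k)‖ = D at *
  rcases le_or_gt D 0 with hD | hD
  · exact hD.trans (by positivity)
  refine le_of_mul_le_mul_right ?_ hD
  have h1 := pow_le_pow_left₀ hD.le hdist 2
  calc D * D = D ^ 2 := (sq D).symm
    _ ≤ c ^ 2 * ‖growthMap A (dualGradient A b q lbar) (l - lbar)‖ ^ 2 := by rwa [← mul_pow]
    _ ≤ c ^ 2 * (2 * (1 + α) * (‖v‖ * D)) := by
        refine mul_le_mul_of_nonneg_left (hgrow.trans ?_) (sq_nonneg c)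
        exact mul_le_mul_of_nonneg_left (by linarith) (by positivity)
    _ = c ^ 2 * (2 * (1 + α)) * ‖v‖ * D := by ring

end DualObjective

theorem mainTheorem2 (m : ℕ) (A : DualSpace m →ₗ[ℝ] EuclideanSpace ℝ (Fin m))
    (b : EuclideanSpace ℝ (Fin m)) (q : DualSpace m) (a₀ α : ℝ) (hα : 0 < α)
    (lbar : DualSpace m)
    (hsol : ∀ l : DualSpace m, dualObjective A b q a₀ α lbar ≤ dualObjective A b q a₀ α l)
    (hblock : BlockCondition A b q α lbar) :
    MetricallySubregularAt (subdifferential (dualObjective A b q a₀ α)) lbar 0 := by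
  have hbar : ∀ i, ‖lbar i‖ ≤ α := fun i => mem_closedBall_zero_iff.1 <| by
    rcases hblock i with h | h
    · exact Metric.isClosed_closedBall.frontier_subset h.1
    · exact interior_subset h
  obtain ⟨c, hc, hker⟩ := (growthMap A (dualGradient A b q lbar)).exists_ker_norm_sub_le
  -- Blocks with zero gradient are strictly interior, an open condition that fixes the radius `ε`.
  have hU : {x : DualSpace m | ∀ i, dualGradient A b q lbar i = 0 → ‖x i‖ < α} ∈ nhds lbar := by
    refine IsOpen.mem_nhds ?_ fun i hi => ?_
    · simp only [Set.ofPred_forall]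
      refine isOpen_iInter_of_finite fun i => isOpen_iInter_of_finite fun _ => ?_
      exact isOpen_lt (by fun_prop) continuous_const
    · rcases hblock i with h | h
      · exact absurd hi h.2.1
      · rw [interior_closedBall _ hα.ne'] at h
        exact mem_ball_zero_iff.1 h
  obtain ⟨ε, hε, hball⟩ := Metric.mem_nhds_iff.1 hU
  have hκ : 0 < c ^ 2 * (2 * (1 + α)) := by positivity
  -- The bound holds for subgradients of any size, so `V` is the whole space.
  refine ⟨zero_mem_subdifferential_of_forall_le hsol, (c ^ 2 * (2 * (1 + α))).toNNReal,
    Metric.ball lbar ε, Metric.ball_mem_nhds _ hε, Set.univ, Filter.univ_mem, fun l hl => ?_⟩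
  obtain ⟨k, hk0, hkn, hkd⟩ := hker (l - lbar)
  have hp : ∀ i, ‖(lbar + k) i‖ ≤ α := by
    intro i
    -- If `gᵢ = 0`, then `‖k‖ ≤ ‖l - lbar‖ < ε` keeps the block in the ball; otherwise `kᵢ = 0`.
    rcases (growthMap_eq_zero_iff.1 hk0).2 i with h | h
    · refine (hball ?_ i h).le
      rw [mem_ball_iff_norm, add_sub_cancel_left]
      exact hkn.trans_lt (mem_ball_iff_norm.1 hl)
    · simpa [h] using hbar i
  have hpS : lbar + k ∈ {x' | 0 ∈ subdifferential (dualObjective A b q a₀ α) x'} := by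
    refine zero_mem_subdifferential_of_forall_le fun y => ?_
    rw [dualObjective_of_forall_norm_le _ _ _ _ hp, dualObjective_add_eq_of_growthMap_eq_zero hk0,
      ← dualObjective_of_forall_norm_le _ _ _ _ hbar]
    exact hsol y
  refine (Metric.infEDist_le_edist_of_mem hpS).trans ?_
  refine Metric.le_mul_infEDist (Real.toNNReal_pos.2 hκ).ne' fun v hv => ?_
  rw [edist_dist, edist_dist, dist_eq_norm, dist_zero_left, ENNReal.ofNNReal_toNNReal,
    ← ENNReal.ofReal_mul hκ.le]
  exact ENNReal.ofReal_le_ofReal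
    (norm_sub_le_of_mem_subdifferential hα hbar hsol hk0 hp hkd hv.1)
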